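/- Let $Z=(Z_1,Z_2,\dots)$ be a sequence of i.i.d. $\mathcal N(0,1)$ random variables, and consider the infinite-dimensional Gaussian channel $X\mapsto Y=X+Z$ on real sequences, i.e. $Y_i=X_i+Z_i$ for all $i\ge 1$, with $Z$ independent of the input. Mutual information is $I(A;B)=D(P_{AB}\,\|\,P_A\otimes P_B)\in[0,\infty]$, in nats. For $t,\gamma\ge 0$ put $$F_I^\infty(t,\gamma)=\sup\Bigl\{I(W;Y)\;:\; W\to X\to Y,\ I(W;X)\le t,\ \mathbb E\|X\|_2^2=\mathbb E\sum_i X_i^2\le\gamma\Bigr\},$$ where the supremum is over all joint distributions $P_{WX}$ (with $W$ taking values in an arbitrary measurable space) satisfying these constraints, and $W\to X\to Y$ means that, conditionally on $(W,X)$, $Y$ is distributed as the output of the channel with input $X$. Then for all $t,\gamma\ge 0$, $$F_I^\infty(t,\gamma)=\min\{t,\gamma/2\}.$$ Consequently no non-trivial strong data processing inequality holds: if $\gamma\ge 0$ and $G:[0,\infty]\to[0,\infty]$ is nondecreasing and $I(W;Y)\le G(I(W;X))$ for all $W\to X\to Y$ with $\mathbb E\|X\|_2^2\le\gamma$, then $G(t)\ge\min\{t,\gamma/2\}$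 for all $t\ge 0$. -/

import Mathlib

open MeasureTheory ProbabilityTheory
open scoped ENNReal NNReal

universe u

namespace StrongDataProcessing

/-- The mutual information `I(A;B) = D(P_{AB} ‖ P_A ⊗ P_B)` (in nats, with values in `[0, ∞]`)
of a pair `(A, B)` with joint law `P`. -/
noncomputable def mutualInfo {α β : Type*} [MeasurableSpace α] [MeasurableSpace β]
    (P : Measure (α × β)) : ℝ≥0∞ :=
  InformationTheory.klDiv P (P.fst.prod P.snd)

/-- The joint law of `((W, X), Y)` for the Markov chain `W → X → Y` in which `(W, X)` has law `P`
and the conditional law of `Y` given `(W, X) = (w, x)` is `K x`. -/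
noncomputable def markovLaw {𝓦 𝓧 𝓨 : Type*} [MeasurableSpace 𝓦] [MeasurableSpace 𝓧]
    [MeasurableSpace 𝓨] (P : Measure (𝓦 × 𝓧)) (K : Kernel 𝓧 𝓨) : Measure ((𝓦 × 𝓧) × 𝓨) :=
  P.compProd (K.prodMkLeft 𝓦)

/-- The joint law of `(W, Y)` in the Markov chain `W → X → Y`. -/
noncomputable def outputLaw {𝓦 𝓧 𝓨 : Type*} [MeasurableSpace 𝓦] [MeasurableSpace 𝓧]
    [MeasurableSpace 𝓨] (P : Measure (𝓦 × 𝓧)) (K : Kernel 𝓧 𝓨) : Measure (𝓦 × 𝓨) :=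
  (markovLaw P K).map (fun p => (p.1.1, p.2))

/-- The best possible data-processing function of the channel `K` with input laws in `𝓘`:
the supremum of `I(W;Y)` over all measurable spaces `𝓦` and all joint laws `P` of `(W, X)` on
`𝓦 × 𝓧` with `P_X ∈ 𝓘` and `I(W;X) ≤ t`, where `W → X → Y` and `Y` is the output of `K`. -/
noncomputable def dataProcessingCurve.{a, v, w} {𝓧 : Type v} {𝓨 : Type w} [MeasurableSpace 𝓧]
    [MeasurableSpace 𝓨] (K : Kernel 𝓧 𝓨) (𝓘 : Set (Measure 𝓧)) (t : ℝ≥0∞) : ℝ≥0∞ :=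
  ⨆ (𝓦 : Type a) (_ : MeasurableSpace 𝓦) (P : Measure (𝓦 × 𝓧)) (_ : IsProbabilityMeasure P)
    (_ : P.snd ∈ 𝓘) (_ : mutualInfo P ≤ t), mutualInfo (outputLaw P K)

/-- The law of the noise `Z = (Z_i)`, with `Z_i ∼ N(0,1)` i.i.d. -/
noncomputable def noiseLaw : Measure (ℕ → ℝ) :=
  Measure.infinitePi (fun _ : ℕ => gaussianReal 0 1)

/-- The infinite-dimensional Gaussian channel `Y_i = X_i + Z_i`: given `X = x`, the output has the
law of `x + Z`. -/
noncomputable def gaussianChannel : Kernel (ℕ → ℝ) (ℕ → ℝ) where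
  toFun x := noiseLaw.map (fun z => x + z)
  measurable' := by
    have : IsProbabilityMeasure noiseLaw := by unfold noiseLaw; infer_instance
    refine Measure.measurable_of_measurable_coe _ fun s hs => ?_
    have h : ∀ x : ℕ → ℝ, noiseLaw.map (fun z => x + z) s
        = noiseLaw (Prod.mk x ⁻¹' ((fun p : (ℕ → ℝ) × (ℕ → ℝ) => p.1 + p.2) ⁻¹' s)) := fun x => by
      rw [Measure.map_apply (by fun_prop) hs]; rfl
    simp_rw [h]
    exact measurable_measure_prodMk_left ((by fun_prop : Measurable
      (fun p : (ℕ → ℝ) × (ℕ → ℝ) => p.1 + p.2)) hs)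

/-- The input laws with total energy `E ‖X‖² = E ∑ X_i² ≤ γ`. -/
def energyConstraint (γ : ℝ≥0) : Set (Measure (ℕ → ℝ)) :=
  {μ | IsProbabilityMeasure μ ∧ ∫⁻ x, ∑' i, ENNReal.ofReal (x i ^ 2) ∂μ ≤ γ}

/-- The curve `F_I^∞(t, γ)` of the infinite-dimensional Gaussian channel under the total energy
constraint `E ‖X‖² ≤ γ`. -/
noncomputable def gaussianCurve.{a} (t γ : ℝ≥0) : ℝ≥0∞ :=
  dataProcessingCurve.{a} gaussianChannel (energyConstraint γ) t

end StrongDataProcessing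

/-! The bound by `t` is data processing. For `γ/2`, replacing the output marginal by the noise law
only increases the divergence, so `I(W;Y) ≤ D(P_{WXY} ‖ P_{WX} ⊗ P_Z)`. This is at most `E‖X‖²/2`,
because `D(N(x,1) ‖ N(0,1)) = x²/2` in each coordinate. To keep the densities finite products, this
is done for the first `n` coordinates (`klDiv_markovLaw_truncatedChannel_le`). The passage to the
limit combines the Donsker–Varadhan formula with martingale convergence
(`klDiv_le_of_forall_trim_le`).

The lower bound is pulse-position modulation at vanishing duty cycle. With probability `1 - l`
nothing is sent; otherwise a pulse of amplitude `√(γ/l)` is sent in one of `M ≈ exp(s/l)` uniformly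
chosen positions. The message entropy is `l log M` plus a binary entropy, hence tends to `s` as `l →
0`. At threshold `√(2s/l)` the noise in a given position gives a false alarm with probability at
most `1/M`, while for `2s < γ` the pulse clears the threshold with probability tending to `1`.
Testing Donsker–Varadhan on the detection event yields `I(W;Y) ≥ s - o(1)`
(`le_mutualInfo_outputLaw_pulseLaw`). Infinite dimension is needed because `M` grows exponentially
in `1/l`. -/

open Filter Topology InformationTheory Real

namespace StrongDataProcessing

/-! ### Donsker–Varadhan formula and divergence along filtrations. -/

section Variational

variable {α : Type*} {mα : MeasurableSpace α} {μ ν : Measure α}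

/-- Young's inequality for the convex conjugates `klFun` and `exp - 1`. -/
lemma mul_sub_exp_le_klFun {r : ℝ} (hr : 0 ≤ r) (c : ℝ) : r * c - (exp c - 1) ≤ klFun r := by
  rw [klFun_apply]
  rcases hr.eq_or_lt with rfl | hr
  · have := exp_pos c
    simp
    linarith
  · have h := add_one_le_exp (c - log r)
    rw [exp_sub, exp_log hr, le_div_iff₀ hr] at h
    nlinarith

/-- Easy half of the Donsker–Varadhan variational formula. -/
lemma ofReal_integral_sub_le_klDiv [IsFiniteMeasure μ] [IsFiniteMeasure ν] {f : α → ℝ}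
    (hf : Measurable f) {B : ℝ} (hB : ∀ x, |f x| ≤ B) :
    ENNReal.ofReal (∫ x, f x ∂μ - ∫ x, (exp (f x) - 1) ∂ν) ≤ klDiv μ ν := by
  by_cases h : klDiv μ ν = ∞
  · simp [h]
  obtain ⟨hac, hint⟩ := klDiv_ne_top_iff.mp h
  rw [klDiv_eq_integral_klFun, if_pos ⟨hac, hint⟩]
  refine ENNReal.ofReal_le_ofReal ?_
  have hfμ : Integrable f μ := .of_bound hf.aestronglyMeasurable B (ae_of_all _ hB)
  have hfν : Integrable (fun x => exp (f x) - 1) ν := by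
    refine Integrable.sub (.of_bound (by fun_prop) (exp B) (ae_of_all _ fun x => ?_))
      (integrable_const _)
    rw [norm_of_nonneg (exp_pos _).le]
    exact exp_le_exp.mpr ((le_abs_self _).trans (hB x))
  have hfr : Integrable (fun x => (μ.rnDeriv ν x).toReal • f x) ν :=
    (integrable_rnDeriv_smul_iff hac).mpr hfμ
  rw [← integral_rnDeriv_smul hac, ← integral_sub hfr hfν]
  refine integral_mono (hfr.sub hfν) ((integrable_klFun_rnDeriv_iff hac).mpr hint) fun x => ?_
  exact mul_sub_exp_le_klFun ENNReal.toReal_nonneg _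

/-- The derivative in `c` is `r/c - 1` and the value at `c = 1` is `0`, so the expression stays
nonnegative as `c` moves from `1` towards `r`. This nonnegativity is what allows Fatou's lemma
below. -/
lemma nonneg_mul_log_clamp {r c : ℝ} (hc : 0 < c) (h : (1 ≤ c ∧ c ≤ r) ∨ (c ≤ 1 ∧ r ≤ c)) :
    0 ≤ r * log c - (c - 1) := by
  have h1 := one_sub_inv_le_log_of_pos hc
  have h2 : c * (1 - c⁻¹) = c - 1 := by field_simp
  rcases h with ⟨h, h'⟩ | ⟨h, h'⟩
  · have := log_nonneg h
    nlinarith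
  · have := log_nonpos hc.le h
    nlinarith

/-- Hard half of the Donsker–Varadhan variational formula. -/
lemma klDiv_le_of_forall_integral_sub_le [IsFiniteMeasure μ] [IsFiniteMeasure ν] {C : ℝ}
    (h : ∀ f : α → ℝ, Measurable f → (∃ B, ∀ x, |f x| ≤ B) →
      ∫ x, f x ∂μ - ∫ x, (exp (f x) - 1) ∂ν ≤ C) :
    klDiv μ ν ≤ ENNReal.ofReal C := by
  -- If `ν s = 0 < μ s`, the test functions `n · 1_s` give the values `n μ(s)`, which exceed `C` for
  -- large `n`.
  have hac : μ ≪ ν := by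
    refine Measure.AbsolutelyContinuous.mk fun s hs hνs => ?_
    by_contra hμs
    have hpos : 0 < μ.real s := by
      rw [measureReal_def]; exact ENNReal.toReal_pos hμs (measure_ne_top _ _)
    obtain ⟨n, hn⟩ := exists_nat_gt (C / μ.real s)
    rw [div_lt_iff₀ hpos] at hn
    have hb := h (s.indicator fun _ => (n : ℝ)) (measurable_const.indicator hs)
      ⟨n, fun x => by by_cases hx : x ∈ s <;> simp [hx]⟩
    have h0 : ∫ x, (exp (s.indicator (fun _ => (n : ℝ)) x) - 1) ∂ν = 0 := by
      refine integral_eq_zero_of_ae ?_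
      filter_upwards [measure_eq_zero_iff_ae_notMem.mp hνs] with x hx
      simp [hx]
    rw [h0, integral_indicator hs] at hb
    simp only [integral_const, smul_eq_mul, measureReal_restrict_apply MeasurableSet.univ,
      Set.univ_inter] at hb
    linarith
  rw [klDiv_eq_lintegral_klFun_of_ac hac]
  set r : α → ℝ := fun x => (μ.rnDeriv ν x).toReal
  have hrm : Measurable r := (Measure.measurable_rnDeriv μ ν).ennreal_toReal
  -- The optimal test function `log r` may be unbounded, so `r` is clamped to `[1/(n+1), n+1]`.
  let c : ℕ → α → ℝ := fun n x => max ((n + 1 : ℝ)⁻¹) (min (n + 1 : ℝ) (r x))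
  have hcpos : ∀ n x, 0 < c n x := fun n x => lt_max_of_lt_left (by positivity)
  have hcm : ∀ n, Measurable (c n) := fun n => by fun_prop
  have hinv : ∀ n : ℕ, ((n : ℝ) + 1)⁻¹ ≤ 1 := fun n => inv_le_one_of_one_le₀ (by simp)
  have hcase : ∀ n x, (1 ≤ c n x ∧ c n x ≤ r x) ∨ (c n x ≤ 1 ∧ r x ≤ c n x) := by
    intro n x
    have h1 := hinv n
    have h2 : (1 : ℝ) ≤ n + 1 := by simp
    rcases le_total 1 (r x) with h | h
    · left
      exact ⟨le_max_of_le_right (le_min h2 h), max_le (h1.trans h) (min_le_right _ _)⟩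
    · right
      exact ⟨max_le h1 ((min_le_right _ _).trans h), le_max_of_le_right (le_min (h.trans h2) le_rfl)⟩
  let F : ℕ → α → ℝ := fun n x => r x * log (c n x) - (c n x - 1)
  have hF0 : ∀ n x, 0 ≤ F n x := fun n x => nonneg_mul_log_clamp (hcpos n x) (hcase n x)
  have hlim : ∀ x, Tendsto (fun n => F n x) atTop (𝓝 (klFun (r x))) := by
    intro x
    have hrx : 0 ≤ r x := ENNReal.toReal_nonneg
    rcases hrx.eq_or_lt with h0 | h0
    · have hc : ∀ n : ℕ, c n x = ((n : ℝ) + 1)⁻¹ := fun n => by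
        simp only [c, ← h0]
        rw [min_eq_right (by positivity), max_eq_left (by positivity)]
      simp only [F, hc, ← h0, klFun_zero]
      have := (tendsto_one_div_add_atTop_nhds_zero_nat (𝕜 := ℝ)).const_sub 1
      simpa using this
    · refine tendsto_const_nhds.congr' ?_
      obtain ⟨k, hk⟩ := exists_nat_gt (max (r x) (r x)⁻¹)
      filter_upwards [eventually_ge_atTop k] with n hn
      have hkn : (k : ℝ) ≤ n := by exact_mod_cast hn
      have h1 : r x ≤ n + 1 := by linarith [le_max_left (r x) (r x)⁻¹]
      have h2 : ((n : ℝ) + 1)⁻¹ ≤ r x := by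
        rw [inv_le_comm₀ (by positivity) h0]
        linarith [le_max_right (r x) (r x)⁻¹]
      have hc : c n x = r x := by simp only [c]; rw [min_eq_right h1, max_eq_right h2]
      simp only [F, hc, klFun_apply]
      ring
  have hbound : ∀ n, ∫⁻ x, ENNReal.ofReal (F n x) ∂ν ≤ ENNReal.ofReal C := by
    intro n
    have hlogb : ∀ x, |log (c n x)| ≤ log (n + 1) := by
      intro x
      rw [abs_le, ← log_inv]
      refine ⟨log_le_log (by positivity) (le_max_left _ _), log_le_log (hcpos n x) ?_⟩
      exact max_le ((hinv n).trans (by simp)) (min_le_left _ _)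
    have hlogm : Measurable fun x => log (c n x) := (hcm n).log
    have hi1 : Integrable (fun x => r x • log (c n x)) ν :=
      (integrable_rnDeriv_smul_iff hac).mpr
        (.of_bound hlogm.aestronglyMeasurable _ (ae_of_all _ hlogb))
    have hi2 : Integrable (fun x => c n x - 1) ν := by
      refine Integrable.sub (.of_bound (hcm n).aestronglyMeasurable (n + 1) (ae_of_all _ fun x => ?_))
        (integrable_const _)
      rw [norm_of_nonneg (hcpos n x).le]
      exact max_le ((hinv n).trans (by simp)) (min_le_left _ _)
    have := h _ hlogm ⟨_, hlogb⟩
    rw [← integral_rnDeriv_smul hac] at this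
    simp_rw [exp_log (hcpos n _)] at this
    rw [← integral_sub hi1 hi2] at this
    exact (ofReal_integral_eq_lintegral_ofReal (hi1.sub hi2) (ae_of_all _ (hF0 n))).ge.trans
      (ENNReal.ofReal_le_ofReal this)
  calc ∫⁻ x, ENNReal.ofReal (klFun (r x)) ∂ν
      = ∫⁻ x, liminf (fun n => ENNReal.ofReal (F n x)) atTop ∂ν := by
        refine lintegral_congr fun x => ?_
        exact ((ENNReal.continuous_ofReal.tendsto _).comp (hlim x)).liminf_eq.symm
    _ ≤ liminf (fun n => ∫⁻ x, ENNReal.ofReal (F n x) ∂ν) atTop :=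
        lintegral_liminf_le fun n => by
          have := hcm n
          fun_prop
    _ ≤ ENNReal.ofReal C := by
        refine (liminf_le_liminf (Eventually.of_forall hbound)).trans ?_
        simp

/-- The Kullback–Leibler divergence is determined by the restrictions to a generating filtration. -/
lemma klDiv_le_of_forall_trim_le [IsFiniteMeasure μ] [IsFiniteMeasure ν]
    (ℱ : Filtration ℕ mα) (hℱ : ⨆ n, ℱ n = mα) {C : ℝ} (hC : 0 ≤ C)
    (h : ∀ n, klDiv (μ.trim (ℱ.le n)) (ν.trim (ℱ.le n)) ≤ ENNReal.ofReal C) :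
    klDiv μ ν ≤ ENNReal.ofReal C := by
  refine klDiv_le_of_forall_integral_sub_le fun f hf ⟨B, hB⟩ => ?_
  -- Conditioning under `μ + ν` gives one approximating sequence that converges almost everywhere
  -- for both measures.
  let ρ := μ + ν
  have hfρ : Integrable f ρ := .of_bound hf.aestronglyMeasurable B (ae_of_all _ hB)
  have hlim := hfρ.tendsto_ae_condExp (ℱ := ℱ) (by rw [hℱ]; exact hf.stronglyMeasurable)
  -- A conditional expectation is bounded only almost everywhere; clamping makes the bound hold
  -- everywhere without changing the limit.
  let g : ℕ → α → ℝ := fun n x => max (-B) (min B ((ρ[f | ℱ n]) x))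
  have hgm : ∀ n, StronglyMeasurable[ℱ n] (g n) := fun n =>
    (by fun_prop : Continuous fun y : ℝ => max (-B) (min B y)).comp_stronglyMeasurable
      stronglyMeasurable_condExp
  have hgB : ∀ n x, |g n x| ≤ B := fun n x => by
    have hB0 : 0 ≤ B := (abs_nonneg _).trans (hB x)
    rw [abs_le]
    exact ⟨le_max_left _ _, max_le (by linarith) (min_le_left _ _)⟩
  have hglim : ∀ᵐ x ∂ρ, Tendsto (fun n => g n x) atTop (𝓝 (f x)) := by
    filter_upwards [hlim] with x hx
    have := tendsto_const_nhds (x := -B) |>.max (tendsto_const_nhds (x := B) |>.min hx)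
    rwa [min_eq_right (abs_le.mp (hB x)).2, max_eq_right (abs_le.mp (hB x)).1] at this
  have hgμ : ∀ᵐ x ∂μ, Tendsto (fun n => g n x) atTop (𝓝 (f x)) :=
    (Measure.AbsolutelyContinuous.rfl.add_right ν).ae_le hglim
  have hgν : ∀ᵐ x ∂ν, Tendsto (fun n => g n x) atTop (𝓝 (f x)) :=
    (Measure.AbsolutelyContinuous.rfl.add_right' μ).ae_le hglim
  have hgm' : ∀ n, StronglyMeasurable (g n) := fun n => (hgm n).mono (ℱ.le n)
  have hem : ∀ n, StronglyMeasurable[ℱ n] fun x => exp (g n x) - 1 := fun n =>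
    (continuous_exp.comp_stronglyMeasurable (hgm n)).sub stronglyMeasurable_const
  have h1 : Tendsto (fun n => ∫ x, g n x ∂μ) atTop (𝓝 (∫ x, f x ∂μ)) :=
    tendsto_integral_of_dominated_convergence (fun _ => B)
      (fun n => (hgm' n).aestronglyMeasurable) (integrable_const _)
      (fun n => ae_of_all _ (hgB n)) hgμ
  have h2 : Tendsto (fun n => ∫ x, (exp (g n x) - 1) ∂ν) atTop (𝓝 (∫ x, (exp (f x) - 1) ∂ν)) := by
    refine tendsto_integral_of_dominated_convergence (fun _ => exp B + 1)
      (fun n => ((hem n).mono (ℱ.le n)).aestronglyMeasurable) (integrable_const _)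
      (fun n => ae_of_all _ fun x => ?_) ?_
    · refine (norm_sub_le _ _).trans ?_
      rw [norm_of_nonneg (exp_pos _).le, norm_one]
      gcongr
      exact (le_abs_self _).trans (hgB n x)
    · filter_upwards [hgν] with x hx
      exact ((continuous_exp.tendsto _).comp hx).sub_const 1
  refine le_of_tendsto (h1.sub h2) (Eventually.of_forall fun n => ?_)
  have h3 := (ofReal_integral_sub_le_klDiv (mα := ℱ n) (μ := μ.trim (ℱ.le n))
    (ν := ν.trim (ℱ.le n)) (hgm n).measurable (hgB n)).trans (h n)
  rw [← integral_trim _ (hgm n), ← integral_trim _ (hem n)] at h3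
  exact (ENNReal.ofReal_le_ofReal_iff hC).mp h3

end Variational

/-! ### Optimality of the product of the marginals. -/

section Golden

variable {α β : Type*} {mα : MeasurableSpace α} {mβ : MeasurableSpace β}

/-- Among all product measures with first factor `μ.fst`, the product of the marginals is closest
to `μ`. -/
lemma klDiv_fst_prod_snd_le (μ : Measure (α × β)) [IsProbabilityMeasure μ] (ν : Measure β)
    [IsProbabilityMeasure ν] : klDiv μ (μ.fst.prod μ.snd) ≤ klDiv μ (μ.fst.prod ν) := by
  by_cases h : klDiv μ (μ.fst.prod ν) = ∞
  · simp [h]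
  obtain ⟨hac, hint⟩ := klDiv_ne_top_iff.mp h
  have hsnd : (μ.fst.prod ν).map Prod.snd = ν := by
    change (μ.fst.prod ν).snd = ν
    simp
  have hacs : μ.snd ≪ ν := by
    have := hac.map measurable_snd
    rwa [hsnd] at this
  have hints : Integrable (llr μ.snd ν) μ.snd := by
    have := integrable_llr_map hac measurable_snd hint
    rwa [hsnd] at this
  let g := μ.snd.rnDeriv ν
  have hgm : Measurable g := Measure.measurable_rnDeriv _ _
  have hprod : μ.fst.prod μ.snd = (μ.fst.prod ν).withDensity (fun p => g p.2) := by
    conv_lhs => rw [← Measure.withDensity_rnDeriv_eq _ _ hacs]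
    rw [prod_withDensity_right hgm]
  have hgpos : ∀ᵐ p ∂μ, 0 < g p.2 := by
    have := Measure.rnDeriv_pos hacs
    exact ae_of_ae_map (f := Prod.snd) measurable_snd.aemeasurable this
  have hac' : μ ≪ μ.fst.prod μ.snd := by
    refine Measure.AbsolutelyContinuous.mk fun s hs h0 => ?_
    rw [hprod, withDensity_apply _ hs, lintegral_eq_zero_iff (by fun_prop),
      EventuallyEq, ae_restrict_iff' hs] at h0
    rw [measure_eq_zero_iff_ae_notMem]
    filter_upwards [hac.ae_le h0, hgpos] with p h1 h2 h3
    exact h2.ne' (h1 h3)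
  -- Chain rule for log-densities: the last term integrates to `D(μ.snd ‖ ν) ≥ 0`, the gap between
  -- the two divergences.
  have hllr : llr μ (μ.fst.prod ν) =ᵐ[μ] fun p => llr μ (μ.fst.prod μ.snd) p + llr μ.snd ν p.2 := by
    have h1 := hac.ae_le (Measure.rnDeriv_mul_rnDeriv (κ := μ.fst.prod ν) hac')
    have h2 : (μ.fst.prod μ.snd).rnDeriv (μ.fst.prod ν) =ᵐ[μ] fun p => g p.2 := by
      rw [hprod]
      exact hac.ae_le (Measure.rnDeriv_withDensity _ (hgm.comp measurable_snd))
    have h3 : ∀ᵐ p ∂μ, g p.2 < ∞ := by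
      have := hacs.ae_le (Measure.rnDeriv_lt_top μ.snd ν)
      exact ae_of_ae_map (f := Prod.snd) measurable_snd.aemeasurable this
    filter_upwards [h1, h2, h3, hgpos, Measure.rnDeriv_pos hac',
      hac'.ae_le (Measure.rnDeriv_lt_top μ (μ.fst.prod μ.snd))] with p h1 h2 h3 h4 h5 h6
    rw [llr, llr, llr, ← h1, Pi.mul_apply, h2, ENNReal.toReal_mul,
      log_mul (ENNReal.toReal_pos h5.ne' h6.ne).ne' (ENNReal.toReal_pos h4.ne' h3.ne).ne']
  have hints' : Integrable (fun p => llr μ.snd ν p.2) μ :=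
    hints.comp_measurable measurable_snd
  have hint' : Integrable (llr μ (μ.fst.prod μ.snd)) μ := by
    refine ((hint.congr hllr).sub hints').congr (ae_of_all _ fun p => ?_)
    simp
  have hnn : 0 ≤ ∫ p, llr μ.snd ν p.2 ∂μ := by
    have h1 := integral_llr_add_sub_measure_univ_nonneg hacs hints
    have h2 : ∫ y, llr μ.snd ν y ∂μ.snd = ∫ p, llr μ.snd ν p.2 ∂μ :=
      integral_map measurable_snd.aemeasurable (stronglyMeasurable_llr _ _).aestronglyMeasurable
    rw [h2] at h1
    simpa using h1
  rw [klDiv_of_ac_of_integrable hac' hint', klDiv_of_ac_of_integrable hac hint,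
    integral_congr_ae hllr, integral_add hint' hints']
  refine ENNReal.ofReal_le_ofReal ?_
  simp only [probReal_univ]
  linarith

end Golden

/-! ### Markov chains and data processing. -/

section Channel

variable {𝓦 𝓧 𝓨 : Type*} [MeasurableSpace 𝓦] [MeasurableSpace 𝓧] [MeasurableSpace 𝓨]
  (P : Measure (𝓦 × 𝓧)) [IsProbabilityMeasure P] (K : Kernel 𝓧 𝓨) [IsMarkovKernel K]

lemma outputLaw_apply {s : Set (𝓦 × 𝓨)} (hs : MeasurableSet s) :
    outputLaw P K s = ∫⁻ p, K p.2 (Prod.mk p.1 ⁻¹' s) ∂P := by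
  have hm : Measurable fun p : (𝓦 × 𝓧) × 𝓨 => (p.1.1, p.2) := by fun_prop
  rw [outputLaw, markovLaw, Measure.map_apply hm hs, Measure.compProd_apply (hm hs)]
  rfl

instance : IsProbabilityMeasure (markovLaw P K) := by
  unfold markovLaw; infer_instance

instance : IsProbabilityMeasure (outputLaw P K) :=
  Measure.isProbabilityMeasure_map (by fun_prop)

/-- Presenting `W → X → Y` as a single kernel acting on the second coordinate makes the data
processing inequality for kernels applicable. -/
lemma outputLaw_eq_comp : outputLaw P K = (Kernel.id ∥ₖ K) ∘ₘ P := by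
  ext s hs
  rw [outputLaw_apply P K hs, Measure.bind_apply hs (Kernel.aemeasurable _)]
  refine lintegral_congr fun p => ?_
  rw [Kernel.parallelComp_apply, Kernel.id_apply, Measure.prod_apply hs,
    lintegral_dirac' _ (measurable_measure_prodMk_left hs)]

lemma fst_outputLaw : (outputLaw P K).fst = P.fst := by
  ext s hs
  rw [Measure.fst_apply hs, outputLaw_apply P K (measurable_fst hs), Measure.fst_apply hs,
    ← lintegral_indicator_one (measurable_fst hs)]
  refine lintegral_congr fun p => ?_
  by_cases h : p.1 ∈ s <;> simp [Set.indicator, Set.preimage_preimage, h]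

lemma snd_outputLaw_apply {s : Set 𝓨} (hs : MeasurableSet s) :
    (outputLaw P K).snd s = ∫⁻ p, K p.2 s ∂P := by
  rw [Measure.snd_apply hs, outputLaw_apply P K (measurable_snd hs)]
  rfl

/-- The data processing inequality for a Markov chain `W → X → Y`. -/
lemma mutualInfo_outputLaw_le : mutualInfo (outputLaw P K) ≤ mutualInfo P := by
  have h : (outputLaw P K).fst.prod (outputLaw P K).snd
      = (Kernel.id ∥ₖ K) ∘ₘ (P.fst.prod P.snd) := by
    rw [fst_outputLaw]
    refine Measure.prod_eq fun s t hs ht => ?_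
    have hK := K.measurable_coe ht
    rw [Measure.bind_apply (hs.prod ht) (Kernel.aemeasurable _)]
    simp_rw [Kernel.parallelComp_apply, Kernel.id_apply, Measure.prod_prod,
      Measure.dirac_apply' _ hs]
    rw [lintegral_prod_mul (f := s.indicator 1) (g := fun x => K x t)
        (measurable_one.indicator hs).aemeasurable hK.aemeasurable,
      lintegral_indicator_one hs, snd_outputLaw_apply P K ht, Measure.snd,
      lintegral_map hK measurable_snd]
  rw [mutualInfo, h, outputLaw_eq_comp, mutualInfo]
  exact klDiv_comp_right_le _ _ _

lemma outputLaw_const (ν : Measure 𝓨) [IsProbabilityMeasure ν] :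
    outputLaw P (Kernel.const 𝓧 ν) = P.fst.prod ν := by
  ext s hs
  rw [outputLaw_apply P _ hs, Measure.prod_apply hs, Measure.fst,
    lintegral_map (measurable_measure_prodMk_left hs) measurable_fst]
  rfl

/-- The true output marginal is replaced by a reference law `ν`, and then `X` is restored, since
forgetting it can only decrease the divergence. The right side involves only the channel densities
relative to `ν`. -/
lemma mutualInfo_outputLaw_le_klDiv (ν : Measure 𝓨) [IsProbabilityMeasure ν] :
    mutualInfo (outputLaw P K) ≤ klDiv (markovLaw P K) (P.prod ν) := by
  have hc : P.prod ν = markovLaw P (Kernel.const 𝓧 ν) := by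
    rw [markovLaw, ← Measure.compProd_const]
    rfl
  calc mutualInfo (outputLaw P K)
      ≤ klDiv (outputLaw P K) ((outputLaw P K).fst.prod ν) := klDiv_fst_prod_snd_le _ _
    _ = klDiv (outputLaw P K) (outputLaw P (Kernel.const 𝓧 ν)) := by
        rw [fst_outputLaw, outputLaw_const]
    _ ≤ klDiv (markovLaw P K) (markovLaw P (Kernel.const 𝓧 ν)) := klDiv_map_le _ _ (by fun_prop)
    _ = _ := by rw [hc]

end Channel

/-! ### Densities of shifted Gaussian noise. -/

lemma klDiv_of_eq_withDensity_ofReal {α : Type*} {mα : MeasurableSpace α} {μ ν : Measure α}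
    [IsProbabilityMeasure μ] [IsProbabilityMeasure ν] {f : α → ℝ} (hf : Measurable f)
    (hf0 : ∀ x, 0 ≤ f x) (hμ : μ = ν.withDensity fun x => ENNReal.ofReal (f x))
    (hint : Integrable (fun x => log (f x)) μ) :
    klDiv μ ν = ENNReal.ofReal (∫ x, log (f x) ∂μ) := by
  have hac : μ ≪ ν := hμ ▸ withDensity_absolutelyContinuous _ _
  have hllr : llr μ ν =ᵐ[μ] fun x => log (f x) := by
    have h : μ.rnDeriv ν =ᵐ[ν] fun x => ENNReal.ofReal (f x) := by
      rw [hμ]; exact Measure.rnDeriv_withDensity _ (by fun_prop)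
    filter_upwards [hac.ae_le h] with x hx
    rw [llr, hx, ENNReal.toReal_ofReal (hf0 x)]
  rw [klDiv_of_ac_of_integrable hac (hint.congr hllr.symm), integral_congr_ae hllr]
  simp

lemma gaussianReal_one_eq_withDensity (a : ℝ) :
    gaussianReal a 1 =
      (gaussianReal 0 1).withDensity fun y => ENNReal.ofReal (exp (a * y - a ^ 2 / 2)) := by
  rw [gaussianReal_of_var_ne_zero _ one_ne_zero, gaussianReal_of_var_ne_zero _ one_ne_zero,
    ← withDensity_mul _ (measurable_gaussianPDF _ _) (by fun_prop)]
  congr 1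
  ext y
  simp only [gaussianPDF_def, gaussianPDFReal_def, Pi.mul_apply]
  rw [← ENNReal.ofReal_mul (by positivity), mul_assoc (√_)⁻¹, ← exp_add]
  congr 3
  simp
  ring

instance : IsProbabilityMeasure noiseLaw := by unfold noiseLaw; infer_instance

instance : IsMarkovKernel gaussianChannel :=
  ⟨fun _ => Measure.isProbabilityMeasure_map (by fun_prop)⟩

lemma gaussianChannel_apply (x : ℕ → ℝ) : gaussianChannel x = noiseLaw.map (fun z => x + z) := rfl

lemma gaussianChannel_eq_infinitePi (x : ℕ → ℝ) :
    gaussianChannel x = Measure.infinitePi fun i => gaussianReal (x i) 1 := by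
  rw [gaussianChannel_apply, noiseLaw]
  have := Measure.infinitePi_map_pi (μ := fun _ : ℕ => gaussianReal 0 1)
    (f := fun i z => x i + z) (fun i => by fun_prop)
  simp only [gaussianReal_map_const_add, zero_add] at this
  exact this

/-- The log-density, with respect to the noise, of the noise shifted by the first `n` coordinates
of `x`. -/
noncomputable def logDensity (n : ℕ) (x y : ℕ → ℝ) : ℝ :=
  ∑ i ∈ Finset.range n, (x i * y i - x i ^ 2 / 2)

@[fun_prop]
lemma measurable_logDensity {α : Type*} [MeasurableSpace α] (n : ℕ) {f g : α → ℕ → ℝ}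
    (hf : Measurable f) (hg : Measurable g) : Measurable fun a => logDensity n (f a) (g a) := by
  unfold logDensity
  fun_prop

/-- Keep the first `n` coordinates and set the others to zero. -/
def truncate (n : ℕ) (x : ℕ → ℝ) (i : ℕ) : ℝ := if i < n then x i else 0

@[fun_prop]
lemma measurable_truncate (n : ℕ) : Measurable (truncate n) := by
  refine measurable_pi_lambda _ fun i => ?_
  unfold truncate
  split_ifs <;> fun_prop

lemma truncate_truncate {m n : ℕ} (h : m ≤ n) (x : ℕ → ℝ) :
    truncate m (truncate n x) = truncate m x := by
  ext i
  simp only [truncate]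
  split_ifs <;> first | rfl | omega

/-- A product law is determined by its values on finite boxes. There the density is a finite product
over coordinates, so independence reduces the claim to the one-dimensional shift formula. -/
lemma gaussianChannel_truncate (n : ℕ) (x : ℕ → ℝ) :
    gaussianChannel (truncate n x) =
      noiseLaw.withDensity fun y => ENNReal.ofReal (exp (logDensity n x y)) := by
  rw [gaussianChannel_eq_infinitePi]
  refine (Measure.eq_infinitePi _ fun s t ht => ?_).symm
  let e : ℕ → ℝ → ℝ≥0∞ := fun i y =>
    ENNReal.ofReal (exp (truncate n x i * y - truncate n x i ^ 2 / 2))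
  have he1 : ∀ i, i ∉ Finset.range n → ∀ y, e i y = 1 := by
    intro i hi y
    have : ¬ i < n := by simpa using hi
    simp [e, truncate, this]
  -- Each factor merges the box constraint with the density in coordinate `i`; it is `1` outside `s
  -- ∪ range n`.
  let g : ℕ → ℝ → ℝ≥0∞ := fun i y => (if i ∈ s then (t i).indicator 1 y else 1) * e i y
  have hem : ∀ i, Measurable (e i) := fun i => by fun_prop
  have hgm : ∀ i, Measurable (g i) := fun i => by
    refine Measurable.mul ?_ (hem i)
    split_ifs
    · exact measurable_one.indicator (ht i)
    · exact measurable_const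
  have hg : ∀ i, ∫⁻ y, g i y ∂gaussianReal 0 1
      = if i ∈ s then gaussianReal (truncate n x i) 1 (t i) else 1 := by
    intro i
    have h1 : ∀ u, MeasurableSet u → gaussianReal (truncate n x i) 1 u
        = ∫⁻ y in u, e i y ∂gaussianReal 0 1 := fun u hu => by
      rw [gaussianReal_one_eq_withDensity, withDensity_apply _ hu]
    split_ifs with hi
    · simp only [g, hi, if_true]
      rw [h1 _ (ht i), ← lintegral_indicator (ht i)]
      refine lintegral_congr fun y => ?_
      by_cases hy : y ∈ t i <;> simp [hy]
    · simp only [g, hi, if_false, one_mul]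
      rw [← setLIntegral_univ, ← h1 _ MeasurableSet.univ, measure_univ]
  have hind : iIndepFun (fun i (y : ℕ → ℝ) => g i (y i)) noiseLaw := iIndepFun_infinitePi hgm
  have hbox : MeasurableSet (Set.pi (s : Set ℕ) t) := .pi s.countable_toSet fun i _ => ht i
  have hdens : ∀ y, (Set.pi (s : Set ℕ) t).indicator
      (fun y => ENNReal.ofReal (exp (logDensity n x y))) y
      = ∏ i ∈ s ∪ Finset.range n, g i (y i) := by
    intro y
    have h1 : ∏ i ∈ s ∪ Finset.range n, e i (y i)
        = ENNReal.ofReal (exp (logDensity n x y)) := by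
      rw [← Finset.prod_subset Finset.subset_union_right fun i _ hi => he1 i hi _, logDensity,
        exp_sum, ENNReal.ofReal_prod_of_nonneg fun i _ => (exp_pos _).le]
      refine Finset.prod_congr rfl fun i hi => ?_
      simp only [e, truncate, if_pos (Finset.mem_range.mp hi)]
    simp only [g]
    rw [Finset.prod_mul_distrib, h1]
    by_cases hy : y ∈ Set.pi (s : Set ℕ) t
    · rw [Set.indicator_of_mem hy, Finset.prod_eq_one, one_mul]
      intro i _
      split_ifs with hi
      · exact Set.indicator_of_mem (hy i hi) _
      · rfl
    · rw [Set.indicator_of_notMem hy]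
      simp only [Set.mem_pi, Finset.mem_coe, not_forall] at hy
      obtain ⟨i, hi, hyi⟩ := hy
      rw [Finset.prod_eq_zero (Finset.mem_union_left _ hi), zero_mul]
      simp [hi, hyi]
  rw [withDensity_apply _ hbox, ← lintegral_indicator hbox, lintegral_congr hdens,
    lintegral_prod_eq_prod_lintegral_of_indepFun _ _ hind
      (fun i => (hgm i).comp (measurable_pi_apply i))]
  have hmarg : ∀ i, ∫⁻ y, g i (y i) ∂noiseLaw
      = if i ∈ s then gaussianReal (truncate n x i) 1 (t i) else 1 := fun i => by
    rw [← hg i, ← Measure.infinitePi_map_eval (fun _ : ℕ => gaussianReal 0 1) i,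
      lintegral_map (hgm i) (measurable_pi_apply i)]
    rfl
  simp_rw [hmarg]
  rw [← Finset.prod_subset Finset.subset_union_left fun i _ hi => by simp [hi]]
  exact Finset.prod_congr rfl fun i hi => by simp [hi]

/-- The Gaussian channel that only transmits the first `n` coordinates of the input. -/
noncomputable def truncatedChannel (n : ℕ) : Kernel (ℕ → ℝ) (ℕ → ℝ) :=
  gaussianChannel.comap (truncate n) (measurable_truncate n)

instance (n : ℕ) : IsMarkovKernel (truncatedChannel n) := by
  unfold truncatedChannel; infer_instance

/-! ### The upper bound `γ/2`. -/

section UpperBound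

variable {𝓦 : Type*} [MeasurableSpace 𝓦] (P : Measure (𝓦 × (ℕ → ℝ))) [IsProbabilityMeasure P]

lemma markovLaw_truncatedChannel_eq_withDensity (n : ℕ) :
    markovLaw P (truncatedChannel n) =
      (P.prod noiseLaw).withDensity fun q => ENNReal.ofReal (exp (logDensity n q.1.2 q.2)) := by
  ext s hs
  have hm : Measurable fun q : (𝓦 × (ℕ → ℝ)) × (ℕ → ℝ) =>
    ENNReal.ofReal (exp (logDensity n q.1.2 q.2)) := by fun_prop
  rw [markovLaw, Measure.compProd_apply hs, withDensity_apply _ hs, ← lintegral_indicator hs,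
    lintegral_prod _ (hm.indicator hs).aemeasurable]
  refine lintegral_congr fun p => ?_
  rw [Kernel.prodMkLeft_apply, truncatedChannel, Kernel.comap_apply, gaussianChannel_truncate,
    withDensity_apply _ (measurable_prodMk_left hs),
    ← lintegral_indicator (measurable_prodMk_left hs)]
  rfl

/-- The density form identifies the log-likelihood ratio; this additive form is the one under which
its expectation is computed. -/
lemma markovLaw_truncatedChannel_eq_map (n : ℕ) :
    markovLaw P (truncatedChannel n) =
      (P.prod noiseLaw).map fun q => (q.1, truncate n q.1.2 + q.2) := by
  have hm : Measurable fun q : (𝓦 × (ℕ → ℝ)) × (ℕ → ℝ) => (q.1, truncate n q.1.2 + q.2) := by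
    fun_prop
  ext s hs
  rw [markovLaw, Measure.compProd_apply hs, Measure.map_apply hm hs, Measure.prod_apply (hm hs)]
  refine lintegral_congr fun p => ?_
  rw [Kernel.prodMkLeft_apply, truncatedChannel, Kernel.comap_apply, gaussianChannel_apply,
    Measure.map_apply (by fun_prop) (measurable_prodMk_left hs)]
  rfl

/-- At the output `x + z` the log-density is `∑ (x_i z_i + x_i²/2)`. The noise is centred and
independent of `x`, so the cross terms vanish and half the energy of the first `n` coordinates
remains. -/
lemma klDiv_markovLaw_truncatedChannel_le (n : ℕ) {γ : ℝ≥0} (hP : P.snd ∈ energyConstraint γ) :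
    klDiv (markovLaw P (truncatedChannel n)) (P.prod noiseLaw) ≤ ENNReal.ofReal (γ / 2) := by
  have hE : ∫⁻ p, ∑' i, ENNReal.ofReal (p.2 i ^ 2) ∂P ≤ γ := by
    have := hP.2
    rwa [Measure.snd, lintegral_map (by fun_prop) measurable_snd] at this
  have hsum : ∑ i ∈ Finset.range n, ∫⁻ p, ENNReal.ofReal (p.2 i ^ 2) ∂P ≤ γ := by
    rw [← lintegral_finsetSum _ fun i _ => by fun_prop]
    exact (lintegral_mono fun p => ENNReal.sum_le_tsum _).trans hE
  have hfin : ∀ i ∈ Finset.range n, ∫⁻ p, ENNReal.ofReal (p.2 i ^ 2) ∂P < ∞ := fun i hi =>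
    ((Finset.single_le_sum (f := fun i => ∫⁻ p, ENNReal.ofReal (p.2 i ^ 2) ∂P)
      (fun _ _ => zero_le) hi).trans hsum).trans_lt ENNReal.coe_lt_top
  have hsq : ∀ i ∈ Finset.range n, Integrable (fun p : 𝓦 × (ℕ → ℝ) => p.2 i ^ 2) P := fun i hi =>
    ⟨by fun_prop, by
      rw [hasFiniteIntegral_iff_ofReal (ae_of_all _ fun p => sq_nonneg _)]; exact hfin i hi⟩
  have h1 : ∀ i ∈ Finset.range n, Integrable (fun p : 𝓦 × (ℕ → ℝ) => p.2 i) P := fun i hi =>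
    ((memLp_two_iff_integrable_sq (by fun_prop)).mpr (hsq i hi)).integrable one_le_two
  have hz : ∀ i, Integrable (fun z : ℕ → ℝ => z i) noiseLaw := fun i => by
    have h := (memLp_id_gaussianReal (μ := 0) (v := 1) 1).integrable le_rfl
    rw [← Measure.infinitePi_map_eval (fun _ : ℕ => gaussianReal 0 1) i] at h
    exact h.comp_measurable (measurable_pi_apply i)
  have hz0 : ∀ i, ∫ z : ℕ → ℝ, z i ∂noiseLaw = 0 := fun i => by
    have h := integral_id_gaussianReal (μ := 0) (v := 1)
    rwa [← Measure.infinitePi_map_eval (fun _ : ℕ => gaussianReal 0 1) i,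
      integral_map (measurable_pi_apply i).aemeasurable (by fun_prop)] at h
  have hm : Measurable fun q : (𝓦 × (ℕ → ℝ)) × (ℕ → ℝ) => (q.1, truncate n q.1.2 + q.2) := by
    fun_prop
  have hH : Measurable fun q : (𝓦 × (ℕ → ℝ)) × (ℕ → ℝ) => logDensity n q.1.2 q.2 := by fun_prop
  have hcomp : ∀ q : (𝓦 × (ℕ → ℝ)) × (ℕ → ℝ), logDensity n q.1.2 (truncate n q.1.2 + q.2)
      = ∑ i ∈ Finset.range n, (q.1.2 i * q.2 i + q.1.2 i ^ 2 / 2) := fun q => by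
    refine Finset.sum_congr rfl fun i hi => ?_
    simp only [Pi.add_apply, truncate, if_pos (Finset.mem_range.mp hi)]
    ring
  have hi1 : ∀ i ∈ Finset.range n, Integrable
      (fun q : (𝓦 × (ℕ → ℝ)) × (ℕ → ℝ) => q.1.2 i * q.2 i) (P.prod noiseLaw) := fun i hi =>
    (h1 i hi).mul_prod (hz i)
  have hi2 : ∀ i ∈ Finset.range n, Integrable
      (fun q : (𝓦 × (ℕ → ℝ)) × (ℕ → ℝ) => q.1.2 i ^ 2 / 2) (P.prod noiseLaw) := fun i hi =>
    ((hsq i hi).comp_fst noiseLaw).div_const 2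
  have hi12 : ∀ i ∈ Finset.range n, Integrable (fun q : (𝓦 × (ℕ → ℝ)) × (ℕ → ℝ) =>
      q.1.2 i * q.2 i + q.1.2 i ^ 2 / 2) (P.prod noiseLaw) := fun i hi => (hi1 i hi).add (hi2 i hi)
  have hint : Integrable (fun q : (𝓦 × (ℕ → ℝ)) × (ℕ → ℝ) => logDensity n q.1.2 q.2)
      (markovLaw P (truncatedChannel n)) := by
    rw [markovLaw_truncatedChannel_eq_map,
      integrable_map_measure hH.aestronglyMeasurable hm.aemeasurable]
    simp only [Function.comp_def, hcomp]
    exact integrable_finsetSum _ hi12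
  rw [klDiv_of_eq_withDensity_ofReal hH.exp (fun q => (exp_pos _).le)
    (markovLaw_truncatedChannel_eq_withDensity P n) (by simpa only [log_exp] using hint)]
  simp only [log_exp]
  refine ENNReal.ofReal_le_ofReal ?_
  rw [markovLaw_truncatedChannel_eq_map, integral_map hm.aemeasurable hH.aestronglyMeasurable]
  simp only [hcomp]
  rw [integral_finsetSum _ hi12]
  have hterm : ∀ i ∈ Finset.range n,
      ∫ q : (𝓦 × (ℕ → ℝ)) × (ℕ → ℝ), (q.1.2 i * q.2 i + q.1.2 i ^ 2 / 2) ∂P.prod noiseLaw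
        = (∫⁻ p, ENNReal.ofReal (p.2 i ^ 2) ∂P).toReal / 2 := fun i hi => by
    rw [integral_add (hi1 i hi) (hi2 i hi),
      integral_prod_mul (fun p : 𝓦 × (ℕ → ℝ) => p.2 i) (fun z : ℕ → ℝ => z i), hz0, mul_zero,
      zero_add, integral_div, integral_fun_fst (fun p : 𝓦 × (ℕ → ℝ) => p.2 i ^ 2),
      integral_eq_lintegral_of_nonneg_ae (ae_of_all _ fun p => sq_nonneg _) (by fun_prop)]
    simp
  rw [Finset.sum_congr rfl hterm, ← Finset.sum_div, ← ENNReal.toReal_sum fun i hi => (hfin i hi).ne]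
  gcongr
  exact ENNReal.toReal_le_coe_of_le_coe hsum

variable (𝓦) in
/-- The information carried by `W` and the first `n` output coordinates. -/
def truncationFiltration :
    Filtration ℕ (inferInstance : MeasurableSpace (𝓦 × (ℕ → ℝ))) where
  seq n := MeasurableSpace.comap (Prod.map id (truncate n)) inferInstance
  mono' m n hmn := by
    have : (Prod.map id (truncate m) : 𝓦 × (ℕ → ℝ) → _) =
        Prod.map id (truncate m) ∘ Prod.map id (truncate n) := by
      funext p
      simp only [Prod.map, Function.comp, truncate_truncate hmn, id]
    beta_reduce
    rw [this, ← MeasurableSpace.comap_comp]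
    exact MeasurableSpace.comap_mono (measurable_id.prodMap (measurable_truncate m)).comap_le
  le' n := (measurable_id.prodMap (measurable_truncate n)).comap_le

lemma iSup_truncationFiltration :
    ⨆ n, truncationFiltration 𝓦 n = (inferInstance : MeasurableSpace (𝓦 × (ℕ → ℝ))) := by
  refine le_antisymm (iSup_le fun n => (truncationFiltration 𝓦).le n) ?_
  have hle : ∀ n, Measurable[⨆ n, truncationFiltration 𝓦 n]
      (Prod.map id (truncate n) : 𝓦 × (ℕ → ℝ) → _) := fun n =>
    (comap_measurable _).mono (le_iSup (truncationFiltration 𝓦 : ℕ → MeasurableSpace _) n) le_rfl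
  have h1 : Measurable[⨆ n, truncationFiltration 𝓦 n] (Prod.fst : 𝓦 × (ℕ → ℝ) → 𝓦) :=
    Measurable.comp (f := Prod.map id (truncate 0)) (g := Prod.fst) measurable_fst (hle 0)
  have h2 : Measurable[⨆ n, truncationFiltration 𝓦 n] (Prod.snd : 𝓦 × (ℕ → ℝ) → _) := by
    refine @measurable_pi_lambda _ _ _ (⨆ n, truncationFiltration 𝓦 n) _ _ fun i => ?_
    have h := ((measurable_pi_apply i).comp measurable_snd).comp (hle (i + 1))
    convert! h using 2 with p
    simp [truncate]
  exact sup_le h1.comap_le h2.comap_le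

lemma trim_truncationFiltration_congr {μ μ' : Measure (𝓦 × (ℕ → ℝ))} (n : ℕ)
    (h : μ.map (Prod.map id (truncate n)) = μ'.map (Prod.map id (truncate n))) :
    μ.trim ((truncationFiltration 𝓦).le n) = μ'.trim ((truncationFiltration 𝓦).le n) := by
  refine @Measure.ext _ (truncationFiltration 𝓦 n) _ _ fun s hs => ?_
  rw [trim_measurableSet_eq _ hs, trim_measurableSet_eq _ hs]
  obtain ⟨t, ht, rfl⟩ := hs
  have hm : Measurable (Prod.map id (truncate n) : 𝓦 × (ℕ → ℝ) → _) :=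
    measurable_id.prodMap (measurable_truncate n)
  rw [← Measure.map_apply hm ht, ← Measure.map_apply hm ht, h]

/-- The first `n` outputs depend only on the first `n` inputs, so on the `n`-th level of the
filtration the two channels are indistinguishable. -/
lemma map_truncate_outputLaw (n : ℕ) :
    (outputLaw P gaussianChannel).map (Prod.map id (truncate n)) =
      (outputLaw P (truncatedChannel n)).map (Prod.map id (truncate n)) := by
  have hm : Measurable (Prod.map id (truncate n) : 𝓦 × (ℕ → ℝ) → _) :=
    measurable_id.prodMap (measurable_truncate n)
  ext s hs
  rw [Measure.map_apply hm hs, Measure.map_apply hm hs, outputLaw_apply _ _ (hm hs),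
    outputLaw_apply _ _ (hm hs)]
  refine lintegral_congr fun p => ?_
  rw [truncatedChannel, Kernel.comap_apply, gaussianChannel_apply, gaussianChannel_apply,
    Measure.map_apply (by fun_prop) (measurable_prodMk_left (hm hs)),
    Measure.map_apply (by fun_prop) (measurable_prodMk_left (hm hs))]
  congr 1
  ext z
  have : truncate n (p.2 + z) = truncate n (truncate n p.2 + z) := by
    ext i
    simp only [truncate, Pi.add_apply]
    split_ifs <;> rfl
  simp [this]

lemma map_truncate_fst_prod_snd (μ : Measure (𝓦 × (ℕ → ℝ))) [IsProbabilityMeasure μ] (n : ℕ) :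
    (μ.fst.prod μ.snd).map (Prod.map id (truncate n)) =
      (μ.map (Prod.map id (truncate n))).fst.prod (μ.map (Prod.map id (truncate n))).snd := by
  rw [← Measure.map_prod_map _ _ measurable_id (measurable_truncate n), Measure.fst, Measure.fst,
    Measure.snd, Measure.snd, Measure.map_map (by fun_prop) (by fun_prop),
    Measure.map_map (by fun_prop) (by fun_prop), Measure.map_map (by fun_prop) (by fun_prop),
    Measure.map_map (by fun_prop) (by fun_prop)]
  rfl

/-- Under the energy constraint, the output of the Gaussian channel carries at most `γ / 2` nats. -/
lemma mutualInfo_outputLaw_gaussianChannel_le {γ : ℝ≥0} (hP : P.snd ∈ energyConstraint γ) :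
    mutualInfo (outputLaw P gaussianChannel) ≤ (γ : ℝ≥0∞) / 2 := by
  have hγ : (γ : ℝ≥0∞) / 2 = ENNReal.ofReal (γ / 2) := by
    rw [ENNReal.ofReal_div_of_pos two_pos]
    simp
  rw [hγ]
  refine klDiv_le_of_forall_trim_le (truncationFiltration 𝓦) iSup_truncationFiltration
    (by positivity) fun n => ?_
  have h := map_truncate_outputLaw P n
  rw [trim_truncationFiltration_congr n h,
    trim_truncationFiltration_congr n (μ := (outputLaw P gaussianChannel).fst.prod _)
      (μ' := (outputLaw P (truncatedChannel n)).fst.prod (outputLaw P (truncatedChannel n)).snd)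
      (by rw [map_truncate_fst_prod_snd, map_truncate_fst_prod_snd, h])]
  exact (klDiv_trim_le _ _ _).trans ((mutualInfo_outputLaw_le_klDiv P _ noiseLaw).trans
    (klDiv_markovLaw_truncatedChannel_le P n hP))

end UpperBound

/-! ### Entropy bound for discrete messages. -/

section Discrete

variable {ι : Type*} [Fintype ι] [MeasurableSpace ι] [DiscreteMeasurableSpace ι]

lemma exists_isProbabilityMeasure_singleton {p : ι → ℝ} (hp : ∀ i, 0 ≤ p i) (hsum : ∑ i, p i = 1) :
    ∃ μ : Measure ι, IsProbabilityMeasure μ ∧ ∀ i, μ {i} = ENNReal.ofReal (p i) := by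
  classical
  have h : ∀ s, MeasurableSet s → (∑ i, ENNReal.ofReal (p i) • Measure.dirac i : Measure ι) s
      = ∑ i, ENNReal.ofReal (p i) * s.indicator 1 i := fun s hs => by
    simp [Measure.finsetSum_apply, Measure.dirac_apply' _ hs]
  refine ⟨∑ i, ENNReal.ofReal (p i) • Measure.dirac i, ⟨?_⟩, fun i => ?_⟩
  · rw [h _ MeasurableSet.univ]
    simp [← ENNReal.ofReal_sum_of_nonneg fun i _ => hp i, hsum]
  · rw [h _ (MeasurableSet.singleton i)]
    simp [Set.indicator_apply]

variable {𝓧 : Type*} [MeasurableSpace 𝓧] (μ : Measure ι) [IsProbabilityMeasure μ]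

/-- The mutual information between a discrete variable with full support and a function of it is
at most its entropy. -/
lemma mutualInfo_map_le_entropy (hμ : ∀ i, μ {i} ≠ 0) (x : ι → 𝓧) :
    mutualInfo (μ.map fun i => (i, x i)) ≤ ENNReal.ofReal (∑ i, negMulLog (μ.real {i})) := by
  classical
  have hx : Measurable x := .of_discrete
  have hd : Measurable fun i : ι => (i, i) := .of_discrete
  have h1 : μ.map (fun i => (i, x i)) = (μ.map fun i => (i, i)).map (Prod.map id x) := by
    rw [Measure.map_map (measurable_id.prodMap hx) hd]
    rfl
  have h2 : (μ.map fun i => (i, x i)).fst.prod (μ.map fun i => (i, x i)).snd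
      = (μ.prod μ).map (Prod.map id x) := by
    rw [← Measure.map_prod_map _ _ measurable_id hx, Measure.fst, Measure.snd,
      Measure.map_map measurable_fst .of_discrete, Measure.map_map measurable_snd .of_discrete]
    rfl
  have : IsProbabilityMeasure (μ.map fun i => (i, i)) :=
    Measure.isProbabilityMeasure_map hd.aemeasurable
  rw [mutualInfo, h2, h1]
  refine (klDiv_map_le _ _ (measurable_id.prodMap hx)).trans_eq ?_
  -- What remains is `I(W;W)`: the diagonal law has density `1/μ{i}` against `μ ⊗ μ`, and its mean
  -- logarithm is the entropy.
  let f : ι × ι → ℝ := fun q => if q.1 = q.2 then (μ.real {q.1})⁻¹ else 0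
  have hf : Measurable f := .of_discrete
  have hdens : μ.map (fun i => (i, i)) =
      (μ.prod μ).withDensity fun q => ENNReal.ofReal (f q) := by
    refine Measure.ext_of_singleton fun ⟨i, j⟩ => ?_
    rw [Measure.map_apply hd (.singleton _), withDensity_apply _ (.singleton _),
      lintegral_singleton, ← Set.singleton_prod_singleton, Measure.prod_prod]
    by_cases hij : i = j
    · subst hij
      have hi : (fun i : ι => (i, i)) ⁻¹' ({i} ×ˢ {i}) = {i} := by ext k; simp
      simp only [hi, f, if_true]
      rw [measureReal_def,
        ENNReal.ofReal_inv_of_pos (ENNReal.toReal_pos (hμ i) (measure_ne_top _ _)),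
        ENNReal.ofReal_toReal (measure_ne_top _ _), ← mul_assoc, ENNReal.inv_mul_cancel (hμ i) (measure_ne_top _ _), one_mul]
    · have hi : (fun i : ι => (i, i)) ⁻¹' ({i} ×ˢ {j}) = ∅ := by
        ext k
        simp only [Set.mem_preimage, Set.mem_prod, Set.mem_singleton_iff, Set.mem_empty_iff_false]
        exact iff_of_false (fun h => hij (h.1.symm.trans h.2)) id
      rw [hi]
      simp [f, hij]
  rw [klDiv_of_eq_withDensity_ofReal hf (fun q => ?_) hdens .of_finite,
    integral_map hd.aemeasurable hf.log.aestronglyMeasurable, integral_fintype .of_finite]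
  · congr 1
    refine Finset.sum_congr rfl fun i _ => ?_
    simp [f, negMulLog, log_inv]
  · simp only [f]
    split_ifs <;> positivity

end Discrete

/-! ### Pulse-position modulation. -/

lemma gaussianReal_real_Ioi_le {τ : ℝ} (hτ : 0 ≤ τ) :
    (gaussianReal 0 1).real (Set.Ioi τ) ≤ exp (-(τ ^ 2 / 2)) := by
  -- Chernoff bound with the optimal parameter `τ`: `exp(-τ²) · exp(τ²/2)`.
  have h := measure_ge_le_exp_mul_mgf (μ := gaussianReal 0 1) (X := id) τ hτ
    (by simpa using integrable_exp_mul_gaussianReal τ)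
  rw [show mgf id (gaussianReal 0 1) τ = exp (τ ^ 2 / 2) by
    rw [mgf_id_gaussianReal]; simp, ← exp_add] at h
  refine (measureReal_mono fun y hy => ?_).trans (h.trans_eq (by ring_nf))
  exact (Set.mem_Ioi.mp hy).le

lemma gaussianChannel_coord (x : ℕ → ℝ) (i : ℕ) {s : Set ℝ} (hs : MeasurableSet s) :
    gaussianChannel x {y | y i ∈ s} = gaussianReal (x i) 1 s := by
  rw [gaussianChannel_eq_infinitePi,
    ← Measure.infinitePi_map_eval (fun i => gaussianReal (x i) 1) i,
    Measure.map_apply (measurable_pi_apply i) hs]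
  rfl

section PulsePosition

/-- The codebook with one zero codeword and orthogonal pulses of amplitude `a`. -/
noncomputable def pulse {κ : Type*} (e : κ → ℕ) (a : ℝ) (w : Option κ) : ℕ → ℝ :=
  w.elim 0 fun k => Pi.single (e k) a

variable {κ : Type*} [Fintype κ] [MeasurableSpace (Option κ)] [DiscreteMeasurableSpace (Option κ)]
  {e : κ → ℕ} (μ : Measure (Option κ)) [IsProbabilityMeasure μ]
  {l a τ : ℝ}

/-- The joint law of the message and the codeword. -/
noncomputable def pulseLaw (μ : Measure (Option κ)) (e : κ → ℕ) (a : ℝ) :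
    Measure (Option κ × (ℕ → ℝ)) :=
  μ.map fun w => (w, pulse e a w)

instance : IsProbabilityMeasure (pulseLaw μ e a) :=
  Measure.isProbabilityMeasure_map (Measurable.of_discrete).aemeasurable

lemma pulseLaw_mem_energyConstraint [Nonempty κ]
    (hμ : ∀ k, μ {some k} = ENNReal.ofReal (l / Fintype.card κ)) {γ : ℝ≥0} (hγ : l * a ^ 2 ≤ γ) :
    (pulseLaw μ e a).snd ∈ energyConstraint γ := by
  refine ⟨inferInstance, ?_⟩
  rw [Measure.snd, lintegral_map (by fun_prop) measurable_snd, pulseLaw,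
    lintegral_map (by fun_prop) .of_discrete, lintegral_fintype, Fintype.sum_option]
  have h : ∀ k : κ, ∑' i, ENNReal.ofReal (pulse e a (some k) i ^ 2) = ENNReal.ofReal (a ^ 2) := by
    intro k
    rw [tsum_eq_single (e k) fun i hi => by simp [pulse, hi]]
    simp [pulse]
  simp only [h, hμ]
  simp only [pulse, Option.elim, Pi.zero_apply, ne_eq, OfNat.ofNat_ne_zero, not_false_eq_true,
    zero_pow, ENNReal.ofReal_zero, tsum_zero, zero_mul, zero_add, Finset.sum_const,
    Finset.card_univ, nsmul_eq_mul]
  rw [← ENNReal.ofReal_mul (sq_nonneg a), ← ENNReal.ofReal_natCast,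
    ← ENNReal.ofReal_mul (Nat.cast_nonneg _), ← ENNReal.ofReal_coe_nnreal]
  refine ENNReal.ofReal_le_ofReal (le_trans (le_of_eq ?_) hγ)
  have : (Fintype.card κ : ℝ) ≠ 0 := by simp
  field_simp

lemma outputLaw_pulseLaw_apply {s : Set (Option κ × (ℕ → ℝ))} (hs : MeasurableSet s) :
    outputLaw (pulseLaw μ e a) gaussianChannel s
      = ∑ w, gaussianChannel (pulse e a w) (Prod.mk w ⁻¹' s) * μ {w} := by
  have hm : Measurable fun w : Option κ => (w, pulse e a w) := .of_discrete
  rw [outputLaw_apply _ _ hs, pulseLaw, lintegral_map ?_ hm, lintegral_fintype]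
  exact Kernel.measurable_kernel_prodMk_left (κ := gaussianChannel.prodMkLeft (Option κ))
    ((by fun_prop : Measurable fun q : (Option κ × (ℕ → ℝ)) × (ℕ → ℝ) => (q.1.1, q.2)) hs)

/-- The event that the output exceeds `τ` in the position of the transmitted pulse. -/
def detection (e : κ → ℕ) (τ : ℝ) : Set (Option κ × (ℕ → ℝ)) :=
  ⋃ k, {some k} ×ˢ {y | y (e k) ∈ Set.Ioi τ}

lemma measurableSet_coord_Ioi (i : ℕ) (τ : ℝ) :
    MeasurableSet {y : ℕ → ℝ | y i ∈ Set.Ioi τ} :=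
  (measurable_pi_apply i) measurableSet_Ioi

lemma measurableSet_detection : MeasurableSet (detection e τ) :=
  .iUnion fun _ => (MeasurableSet.singleton _).prod (measurableSet_coord_Ioi _ _)

lemma gaussianReal_Ioi (a τ : ℝ) :
    gaussianReal a 1 (Set.Ioi τ) = gaussianReal 0 1 (Set.Ioi (τ - a)) := by
  have := gaussianReal_map_const_add (μ := 0) (v := 1) a
  rw [zero_add] at this
  rw [← this, Measure.map_apply (by fun_prop) measurableSet_Ioi]
  congr 1
  ext y
  simp [sub_lt_iff_lt_add']

lemma outputLaw_pulseLaw_detection [Nonempty κ] (hl : 0 ≤ l)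
    (hμ : ∀ k, μ {some k} = ENNReal.ofReal (l / Fintype.card κ)) :
    (outputLaw (pulseLaw μ e a) gaussianChannel).real (detection e τ)
      = l * (gaussianReal 0 1).real (Set.Ioi (τ - a)) := by
  have h1 : ∀ k, gaussianChannel (pulse e a (some k)) (Prod.mk (some k) ⁻¹' detection e τ)
      = gaussianReal 0 1 (Set.Ioi (τ - a)) := by
    intro k
    have : Prod.mk (some k) ⁻¹' detection e τ = {y | y (e k) ∈ Set.Ioi τ} := by
      ext y; simp [detection]
    rw [this, gaussianChannel_coord _ _ measurableSet_Ioi, ← gaussianReal_Ioi]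
    simp [pulse]
  have h0 : Prod.mk none ⁻¹' detection e τ = ∅ := by ext y; simp [detection]
  rw [measureReal_def, outputLaw_pulseLaw_apply _ measurableSet_detection, Fintype.sum_option, h0]
  simp only [h1, hμ, measure_empty, zero_mul, zero_add, Finset.sum_const, Finset.card_univ,
    nsmul_eq_mul, ENNReal.toReal_mul, ENNReal.toReal_natCast]
  rw [ENNReal.toReal_ofReal (by positivity), ← measureReal_def]
  have : (Fintype.card κ : ℝ) ≠ 0 := by simp
  field_simp

/-- Under the product law the output is independent of the message. Position `k` exceeds `τ` with
probability at most `l/M` (its own pulse) plus `1/M` (noise alone), hence at most `2/M`; weighting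
by `l/M` and summing over `M` positions gives the bound. -/
lemma fst_prod_snd_detection_le [Nonempty κ] (he : Function.Injective e) (hl0 : 0 ≤ l) (hl1 : l ≤ 1) (hτ : 0 ≤ τ)
    (hμ : ∀ k, μ {some k} = ENNReal.ofReal (l / Fintype.card κ))
    (hM : exp (-(τ ^ 2 / 2)) ≤ (Fintype.card κ : ℝ)⁻¹) :
    ((outputLaw (pulseLaw μ e a) gaussianChannel).fst.prod
      (outputLaw (pulseLaw μ e a) gaussianChannel).snd).real (detection e τ)
      ≤ 2 * l / Fintype.card κ := by
  classical
  set ρ := outputLaw (pulseLaw μ e a) gaussianChannel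
  set M : ℝ := (Fintype.card κ : ℝ)
  have hM0 : 0 < M := by simp [M, Fintype.card_pos]
  have hfst : ∀ k, ρ.fst {some k} = ENNReal.ofReal (l / M) := fun k => by
    rw [fst_outputLaw, pulseLaw, Measure.fst, Measure.map_map measurable_fst .of_discrete, ← hμ k]
    have : Prod.fst ∘ (fun w : Option κ => (w, pulse e a w)) = id := rfl
    rw [this, Measure.map_id]
  have hsnd : ∀ k, ρ.snd {y | y (e k) ∈ Set.Ioi τ} ≤ ENNReal.ofReal (l / M + M⁻¹) := by
    intro k
    have hs := measurableSet_coord_Ioi (e k) τ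
    rw [Measure.snd_apply hs, outputLaw_pulseLaw_apply _ (measurable_snd hs)]
    change ∑ w, gaussianChannel (pulse e a w) {y | y (e k) ∈ Set.Ioi τ} * μ {w} ≤ _
    rw [← Finset.add_sum_erase _ _ (Finset.mem_univ (some k)),
      ENNReal.ofReal_add (by positivity) (by positivity)]
    refine add_le_add ?_ ?_
    · rw [← hμ k]
      exact mul_le_of_le_one_left' prob_le_one
    · have hq : gaussianReal 0 1 (Set.Ioi τ) ≤ ENNReal.ofReal M⁻¹ := by
        rw [← ofReal_measureReal]
        exact ENNReal.ofReal_le_ofReal ((gaussianReal_real_Ioi_le hτ).trans hM)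
      calc ∑ w ∈ Finset.univ.erase (some k),
            gaussianChannel (pulse e a w) {y | y (e k) ∈ Set.Ioi τ} * μ {w}
          ≤ ∑ w ∈ Finset.univ.erase (some k), ENNReal.ofReal M⁻¹ * μ {w} := by
            refine Finset.sum_le_sum fun w hw => ?_
            have hw0 : pulse e a w (e k) = 0 := by
              rcases w with _ | j
              · rfl
              · have : k ≠ j := fun h => (Finset.mem_erase.mp hw).1 (by rw [h])
                simp [pulse, he.ne this]
            rw [gaussianChannel_coord _ _ measurableSet_Ioi, hw0]
            gcongr
        _ ≤ ∑ w, ENNReal.ofReal M⁻¹ * μ {w} :=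
            Finset.sum_le_sum_of_subset (Finset.erase_subset _ _)
        _ = ENNReal.ofReal M⁻¹ := by
            rw [← Finset.mul_sum, sum_measure_singleton]
            simp
  have hle : (ρ.fst.prod ρ.snd) (detection e τ) ≤ ENNReal.ofReal (2 * l / M) := by
    calc (ρ.fst.prod ρ.snd) (detection e τ)
        ≤ ∑ k, (ρ.fst.prod ρ.snd) ({some k} ×ˢ {y | y (e k) ∈ Set.Ioi τ}) :=
          measure_iUnion_fintype_le _ _
      _ ≤ ∑ _k : κ, ENNReal.ofReal (l / M * (2 / M)) := by
          refine Finset.sum_le_sum fun k _ => ?_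
          rw [Measure.prod_prod, hfst, ENNReal.ofReal_mul (by positivity)]
          gcongr
          refine (hsnd k).trans (ENNReal.ofReal_le_ofReal ?_)
          rw [← one_div, ← add_div]
          gcongr
          linarith
      _ = ENNReal.ofReal (2 * l / M) := by
          rw [Finset.sum_const, Finset.card_univ, nsmul_eq_mul, ← ENNReal.ofReal_natCast,
            ← ENNReal.ofReal_mul (Nat.cast_nonneg _)]
          congr 1
          change M * _ = _
          field_simp
  exact ENNReal.toReal_le_of_le_ofReal (by positivity) hle

/-- Donsker–Varadhan with test function `log M` on the detection event: the gain is `log M` times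
the joint probability, the cost is `M - 1` times the product probability, at most `2l`. -/
lemma le_mutualInfo_outputLaw_pulseLaw [Nonempty κ] (he : Function.Injective e) (hl0 : 0 ≤ l) (hl1 : l ≤ 1) (hτ : 0 ≤ τ)
    (hμ : ∀ k, μ {some k} = ENNReal.ofReal (l / Fintype.card κ))
    (hM : exp (-(τ ^ 2 / 2)) ≤ (Fintype.card κ : ℝ)⁻¹) :
    ENNReal.ofReal (l * log (Fintype.card κ) * (gaussianReal 0 1).real (Set.Ioi (τ - a)) - 2 * l)
      ≤ mutualInfo (outputLaw (pulseLaw μ e a) gaussianChannel) := by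
  set M : ℝ := (Fintype.card κ : ℝ) with hMdef
  have hM1 : 1 ≤ M := by
    rw [hMdef]; exact_mod_cast Nat.one_le_iff_ne_zero.mpr Fintype.card_ne_zero
  have hA := measurableSet_detection (e := e) (τ := τ)
  set A := detection e τ
  have h := ofReal_integral_sub_le_klDiv (μ := outputLaw (pulseLaw μ e a) gaussianChannel)
    (ν := (outputLaw (pulseLaw μ e a) gaussianChannel).fst.prod
      (outputLaw (pulseLaw μ e a) gaussianChannel).snd)
    (f := A.indicator fun _ => log M) (measurable_const.indicator hA) (B := log M) fun q => by
      by_cases hq : q ∈ A <;> simp [hq, abs_of_nonneg, log_nonneg hM1]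
  refine le_trans (ENNReal.ofReal_le_ofReal ?_) h
  have hexp : (fun q => exp (A.indicator (fun _ => log M) q) - 1)
      = A.indicator fun _ => M - 1 := by
    ext q
    by_cases hq : q ∈ A <;> simp [hq, exp_log (zero_lt_one.trans_le hM1)]
  rw [hexp, integral_indicator_const _ hA, integral_indicator_const _ hA,
    outputLaw_pulseLaw_detection μ hl0 hμ, smul_eq_mul, smul_eq_mul]
  have h2 := fst_prod_snd_detection_le μ he (a := a) hl0 hl1 hτ hμ hM
  have h3 : (2 * l / M) * (M - 1) ≤ 2 * l := by
    rw [div_mul_eq_mul_div, div_le_iff₀ (by linarith)]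
    nlinarith
  have h4 := mul_le_mul_of_nonneg_right h2 (sub_nonneg.mpr hM1)
  have h5 : l * log M * (gaussianReal 0 1).real (Set.Ioi (τ - a))
    = l * (gaussianReal 0 1).real (Set.Ioi (τ - a)) * log M := by ring
  linarith

lemma mutualInfo_pulseLaw_le [Nonempty κ] (hl0 : 0 < l) (hl1 : l < 1)
    (h0 : μ {none} = ENNReal.ofReal (1 - l))
    (hμ : ∀ k, μ {some k} = ENNReal.ofReal (l / Fintype.card κ)) :
    mutualInfo (pulseLaw μ e a)
      ≤ ENNReal.ofReal (negMulLog (1 - l) + negMulLog l + l * log (Fintype.card κ)) := by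
  have hM : (0 : ℝ) < Fintype.card κ := by exact_mod_cast Fintype.card_pos
  refine (mutualInfo_map_le_entropy μ (fun w => ?_) _).trans_eq ?_
  · rcases w with _ | k
    · rw [h0]; simpa using hl1
    · rw [hμ]; simpa using div_pos hl0 hM
  · congr 1
    rw [Fintype.sum_option]
    simp only [measureReal_def, h0, hμ, Finset.sum_const, Finset.card_univ, nsmul_eq_mul]
    rw [ENNReal.toReal_ofReal (by linarith), ENNReal.toReal_ofReal (by positivity), add_assoc]
    congr 1
    rw [negMulLog, negMulLog, log_div hl0.ne' hM.ne']
    field_simp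
    ring

end PulsePosition

/-! ### Choice of parameters and the limit of vanishing duty cycle. -/

lemma le_gaussianCurve {t γ : ℝ≥0} {s l : ℝ} (hs : 0 ≤ s) (hl0 : 0 < l) (hl1 : l < 1) {M : ℕ}
    (hM0 : M ≠ 0) (hM : (M : ℝ) ≤ exp (s / l))
    (ht : negMulLog (1 - l) + negMulLog l + s ≤ t) :
    ENNReal.ofReal (l * log M * (gaussianReal 0 1).real (Set.Ioi (√(2 * s / l) - √(γ / l))) - 2 * l)
      ≤ gaussianCurve.{u} t γ := by
  -- The lift places the message space in the universe over which the supremum runs.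
  let κ := ULift.{u} (Fin M)
  let e : κ → ℕ := fun k => k.down
  have he : Function.Injective e := fun i j h => ULift.down_injective (Fin.val_injective h)
  have : Nonempty κ := ⟨⟨⟨0, Nat.pos_of_ne_zero hM0⟩⟩⟩
  let _ : MeasurableSpace (Option κ) := ⊤
  have hcard : Fintype.card κ = M := by simp [κ]
  have hMpos : (0 : ℝ) < M := by exact_mod_cast Nat.pos_of_ne_zero hM0
  obtain ⟨μ, _, hμ⟩ := exists_isProbabilityMeasure_singleton (ι := Option κ)
    (p := fun w => w.elim (1 - l) fun _ => l / Fintype.card κ)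
    (fun w => by
      rcases w with _ | k
      · exact sub_nonneg.mpr hl1.le
      · exact div_nonneg hl0.le (Nat.cast_nonneg _))
    (by
      rw [Fintype.sum_option]
      simp only [Option.elim, Finset.sum_const, Finset.card_univ, nsmul_eq_mul, hcard]
      field_simp
      ring)
  have hμk : ∀ k, μ {some k} = ENNReal.ofReal (l / Fintype.card κ) := fun k => hμ (some k)
  have hlog : l * log M ≤ s := by
    have := (log_le_iff_le_exp hMpos).mpr hM
    rwa [le_div_iff₀' hl0] at this
  -- The threshold `√(2s/l)` is chosen so that the tail bound equals `exp(-s/l) ≤ 1/M`.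
  have hexp : exp (-(√(2 * s / l) ^ 2 / 2)) ≤ (Fintype.card κ : ℝ)⁻¹ := by
    rw [sq_sqrt (by positivity), exp_neg, hcard]
    refine inv_anti₀ hMpos (hM.trans_eq ?_)
    congr 1
    ring
  have hI : mutualInfo (pulseLaw μ e (√(γ / l))) ≤ t := by
    refine (mutualInfo_pulseLaw_le μ hl0 hl1 (hμ none) hμk).trans ?_
    rw [← ENNReal.ofReal_coe_nnreal, hcard]
    exact ENNReal.ofReal_le_ofReal (by linarith)
  -- The amplitude `√(γ/l)` spends the energy budget exactly.
  have hE : (pulseLaw μ e (√(γ / l))).snd ∈ energyConstraint γ := by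
    refine pulseLaw_mem_energyConstraint μ hμk (le_of_eq ?_)
    rw [sq_sqrt (by positivity)]
    field_simp
  have h := le_mutualInfo_outputLaw_pulseLaw (a := √(γ / l)) μ he hl0.le hl1.le (sqrt_nonneg _)
    hμk hexp
  rw [hcard] at h
  refine h.trans ?_
  rw [gaussianCurve, dataProcessingCurve]
  exact le_iSup_of_le (Option κ) <| le_iSup_of_le inferInstance <|
    le_iSup_of_le (pulseLaw μ e (√(γ / l))) <| le_iSup_of_le inferInstance <|
    le_iSup_of_le hE <| le_iSup_of_le hI le_rfl

lemma ofReal_le_gaussianCurve {t γ : ℝ≥0} {s : ℝ} (hs : 0 ≤ s) (hst : s < t) (hsγ : 2 * s < γ) :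
    ENNReal.ofReal s ≤ gaussianCurve.{u} t γ := by
  let p : ℝ → ℝ := fun l => (gaussianReal 0 1).real (Set.Ioi (√(2 * s / l) - √(γ / l)))
  have hid : Tendsto (fun l : ℝ => l) (𝓝[>] 0) (𝓝 0) := tendsto_id.mono_left nhdsWithin_le_nhds
  -- The argument equals `(√(2s) - √γ)/√l`, with a negative numerator because `2s < γ`.
  have harg : Tendsto (fun l : ℝ => √(2 * s / l) - √(γ / l)) (𝓝[>] 0) atBot := by
    have h1 : Tendsto (fun l : ℝ => √(l⁻¹)) (𝓝[>] 0) atTop :=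
      tendsto_sqrt_atTop.comp tendsto_inv_nhdsGT_zero
    have h2 : √(2 * s) - √γ < 0 := sub_neg.mpr (sqrt_lt_sqrt (by positivity) hsγ)
    refine (h1.const_mul_atTop_of_neg h2).congr' ?_
    filter_upwards [self_mem_nhdsWithin] with l hl
    rw [div_eq_mul_inv, div_eq_mul_inv, sqrt_mul (by positivity : 0 ≤ 2 * s),
      sqrt_mul γ.coe_nonneg, sub_mul]
  have hp : Tendsto p (𝓝[>] 0) (𝓝 1) := by
    have h := ((tendsto_cdf_atBot (gaussianReal 0 1)).comp harg).const_sub 1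
    rw [sub_zero] at h
    refine h.congr fun l => ?_
    rw [Function.comp, cdf_eq_real, ← probReal_compl_eq_one_sub measurableSet_Iic, Set.compl_Iic]
  have hlim : Tendsto (fun l => (s - l * log 2) * p l - 2 * l) (𝓝[>] 0) (𝓝 s) := by
    have := (((hid.mul_const (log 2)).const_sub s).mul hp).sub (hid.const_mul 2)
    simpa using this
  have hent : ∀ᶠ l in 𝓝[>] (0 : ℝ), negMulLog (1 - l) + negMulLog l + s < t := by
    have hc : Continuous fun l : ℝ => negMulLog (1 - l) + negMulLog l + s := by fun_prop
    have h := (hc.tendsto 0).mono_left (nhdsWithin_le_nhds (s := Set.Ioi 0))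
    simp only [sub_zero, negMulLog_one, negMulLog_zero, zero_add] at h
    exact h.eventually_lt_const hst
  refine le_of_tendsto ((ENNReal.continuous_ofReal.tendsto s).comp hlim) ?_
  filter_upwards [hent, self_mem_nhdsWithin, Ioo_mem_nhdsGT zero_lt_one] with l hl hl0 hl1
  rw [Set.mem_Ioi] at hl0
  have hexp1 : 1 ≤ exp (s / l) := one_le_exp (by positivity)
  have hM0 : ⌊exp (s / l)⌋₊ ≠ 0 := (Nat.floor_pos.mpr hexp1).ne'
  refine le_trans (ENNReal.ofReal_le_ofReal ?_)
    (le_gaussianCurve hs hl0 hl1.2 hM0 (Nat.floor_le (exp_pos _).le) hl.le)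
  have hM1 : (1 : ℝ) ≤ ⌊exp (s / l)⌋₊ := by exact_mod_cast Nat.pos_of_ne_zero hM0
  -- Rounding down loses at most a factor `2`, as `x ≤ 2⌊x⌋` for `x ≥ 1`.
  have hlog : s / l - log 2 ≤ log ⌊exp (s / l)⌋₊ := by
    rw [sub_le_iff_le_add, ← log_mul (by positivity) two_ne_zero, le_log_iff_exp_le (by positivity)]
    linarith [Nat.lt_floor_add_one (exp (s / l))]
  have hlog' : s - l * log 2 ≤ l * log ⌊exp (s / l)⌋₊ := by
    have := mul_le_mul_of_nonneg_left hlog hl0.le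
    rwa [mul_sub, mul_div_cancel₀ _ hl0.ne'] at this
  exact sub_le_sub_right (mul_le_mul_of_nonneg_right hlog' measureReal_nonneg) _

lemma gaussianCurve_eq (t γ : ℝ≥0) :
    gaussianCurve.{u} t γ = min (t : ℝ≥0∞) ((γ : ℝ≥0∞) / 2) := by
  refine le_antisymm ?_ (le_of_forall_lt fun b hb => ?_)
  · simp only [gaussianCurve, dataProcessingCurve]
    refine iSup_le fun 𝓦 => iSup_le fun _ => iSup_le fun P => iSup_le fun _ => iSup_le fun hE =>
      iSup_le fun hI => le_min ((mutualInfo_outputLaw_le P _).trans hI) ?_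
    exact mutualInfo_outputLaw_gaussianChannel_le P hE
  -- An intermediate value supplies the strict inequalities `c < t` and `2c < γ` needed for the
  -- coding argument.
  · obtain ⟨c, hbc, hc⟩ := exists_between hb
    refine hbc.trans_le ?_
    have hctop : c ≠ ∞ := (hc.trans_le (min_le_left _ _)).ne_top
    lift c to ℝ≥0 using hctop
    rw [← ENNReal.ofReal_coe_nnreal]
    refine ofReal_le_gaussianCurve c.2 ?_ ?_
    · exact_mod_cast hc.trans_le (min_le_left _ _)
    · have h := hc.trans_le (min_le_right _ _)
      rw [ENNReal.lt_div_iff_mul_lt (by simp) (by simp), mul_comm] at h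
      exact_mod_cast h

end StrongDataProcessing

theorem mainTheorem9 (γ : ℝ≥0) :
    (∀ t : ℝ≥0, StrongDataProcessing.gaussianCurve.{u} t γ = min (t : ℝ≥0∞) ((γ : ℝ≥0∞) / 2)) ∧
    (∀ G : ℝ≥0∞ → ℝ≥0∞, Monotone G →
      (∀ (𝓦 : Type u) [MeasurableSpace 𝓦] (P : Measure (𝓦 × (ℕ → ℝ))) [IsProbabilityMeasure P],
        P.snd ∈ StrongDataProcessing.energyConstraint γ →
        StrongDataProcessing.mutualInfo
            (StrongDataProcessing.outputLaw P StrongDataProcessing.gaussianChannel) ≤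
          G (StrongDataProcessing.mutualInfo P)) →
      ∀ t : ℝ≥0, min (t : ℝ≥0∞) ((γ : ℝ≥0∞) / 2) ≤ G t) := by
  refine ⟨fun t => StrongDataProcessing.gaussianCurve_eq t γ, fun G hG h t => ?_⟩
  -- Whenever `I(W;X) ≤ t`, monotonicity gives `I(W;Y) ≤ G t`, so `G t` dominates the whole
  -- supremum.
  rw [← StrongDataProcessing.gaussianCurve_eq.{u} t γ, StrongDataProcessing.gaussianCurve,
    StrongDataProcessing.dataProcessingCurve]
  exact iSup_le fun 𝓦 => iSup_le fun _ => iSup_le fun P => iSup_le fun _ => iSup_le fun hE =>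
    iSup_le fun hI => (h 𝓦 P hE).trans (hG hI)
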